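/- Let $0<\gamma<\delta\le 1$. For $n\ge 1$ let $X^{(n)}$ be the number of cycles of length in the closed interval $[\gamma n,\delta n]$ of a uniformly random permutation of $[n]$ (fixed points are cycles of length $1$). Write $(x)_r=x(x-1)\cdots(x-r+1)$, with $(x)_0=1$, and $K=\lfloor 1/\gamma\rfloor$. For every integer $r\ge 0$ the factorial moment $\mathbb{E}\,(X^{(n)})_r$ converges as $n\to\infty$, with limit $$q_r=\int_{z_1+\cdots+z_r\le 1,\ z_1,\dots,z_r\in[\gamma,\delta]}\frac{1}{z_1\cdots z_r}\,dz_1\cdots dz_r\qquad(q_0=1).$$ For every integer $i\ge 0$ the probability $\mathbb{P}(X^{(n)}=i)$ converges as $n\to\infty$ to a limit $p_i$. Moreover $p_i=0$ for $i>K$, and $(p_0,\dots,p_K)$ is the unique solution in $\mathbb{R}^{K+1}$ of the linear system $$\sum_{j=0}^{K}(j)_r\,x_j=q_r,\qquad r=0,1,\dots,K.$$ -/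

import Mathlib

open Filter Topology MeasureTheory

namespace LongCycles

/-- The number of cycles of `σ` (fixed points count as cycles of length one) whose length lies in
the closed interval `[γ n, δ n]`. Mathlib's `Equiv.Perm.partition` is the multiset of all cycle
lengths of `σ`, fixed points included. -/
noncomputable def cycleCount (γ δ : ℝ) {n : ℕ} (σ : Equiv.Perm (Fin n)) : ℕ :=
  σ.partition.parts.countP (fun k : ℕ => γ * (n : ℝ) ≤ (k : ℝ) ∧ (k : ℝ) ≤ δ * (n : ℝ))

/-- Expectation of `f` under the uniform distribution on the permutations of `[n]`. -/
noncomputable def expect (n : ℕ) (f : Equiv.Perm (Fin n) → ℝ) : ℝ :=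
  (∑ σ : Equiv.Perm (Fin n), f σ) / (Fintype.card (Equiv.Perm (Fin n)) : ℝ)

/-- The probability that a uniformly random permutation of `[n]` has exactly `i` cycles of length
in `[γ n, δ n]`. -/
noncomputable def cycleProb (γ δ : ℝ) (i n : ℕ) : ℝ :=
  ((Finset.univ.filter (fun σ : Equiv.Perm (Fin n) => cycleCount γ δ σ = i)).card : ℝ) /
    (Fintype.card (Equiv.Perm (Fin n)) : ℝ)

/-- The `r`-th factorial moment `E (X)_r = E [X (X - 1) ⋯ (X - r + 1)]` of the number `X` of cycles
of length in `[γ n, δ n]` of a uniformly random permutation of `[n]`. -/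
noncomputable def cycleFactorialMoment (γ δ : ℝ) (r n : ℕ) : ℝ :=
  expect n (fun σ => ((cycleCount γ δ σ).descFactorial r : ℝ))

/-- The part `z₁ + ⋯ + z_r ≤ 1` of the cube `[γ, δ]^r`. -/
def slicedCube (γ δ : ℝ) (r : ℕ) : Set (Fin r → ℝ) :=
  {z | (∀ j, γ ≤ z j ∧ z j ≤ δ) ∧ ∑ j, z j ≤ 1}

/-- The integral of `1 / (z₁ ⋯ z_r)` over the sliced cube. For `γ > 0` the integrand is continuous
on this compact set. -/
noncomputable def limitMoment (γ δ : ℝ) (r : ℕ) : ℝ :=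
  ∫ z in slicedCube γ δ r, 1 / ∏ j, z j

end LongCycles

/-!
The proof is the method of moments for a bounded random variable.

By Cauchy's formula (`card_partition_eq`) the cycle lengths of a uniformly random permutation form
a given partition of `n` with probability `1 / z`, where `z = ∏ k ^ m_k m_k!`. Deleting a part `k`
of multiplicity `m_k` multiplies this weight by `k m_k`, which gives a recursion for the factorial
moments (`partitionMoment_succ`) with the exact solution
`E (X)_r = ∑ 1 / (k₁ ⋯ k_r)`, the sum over tuples of integers in `[γ n, δ n]` with
`k₁ + ⋯ + k_r ≤ n` (`partitionMoment_eq_sum_tuples`). With `z_j = k_j / n` this is a Riemann sum of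
mesh `1 / n` for the integral of `1 / (z₁ ⋯ z_r)` over the sliced cube, a compact convex set, and so
it converges to that integral (`tendsto_cycleFactorialMoment`).

Cycles of length at least `γ n` number at most `K = ⌊1 / γ⌋`, so the factorial moments of order
`0, …, K` are the image of the distribution of `X` under the matrix `(j)_r`
(`sum_descFactorial_mul_cycleProb`). This matrix is triangular with diagonal entries `r! ≠ 0`.
Applying its inverse to the convergent moments gives the convergence of the probabilities, and the
limit is the unique solution of the linear system.
-/

namespace LongCycles

/-! ### The law of the cycle type -/

/-- The reciprocal `1 / z_M` of `z_M = ∏ k ^ m_k m_k!`, where `m_k` is the multiplicity of `k` in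
`M`: the probability that the cycle lengths of a uniformly random permutation form the multiset
`M`. -/
noncomputable def zWeight (M : Multiset ℕ) : ℝ :=
  1 / ((M.prod : ℝ) * ∏ k ∈ M.toFinset, ((M.count k).factorial : ℝ))

theorem prod_factorial_count_cons (k : ℕ) (M : Multiset ℕ) :
    ∏ j ∈ (k ::ₘ M).toFinset, (((k ::ₘ M).count j).factorial : ℝ) =
      (M.count k + 1) * ∏ j ∈ M.toFinset, ((M.count j).factorial : ℝ) := by
  have h : ∏ j ∈ M.toFinset, ((M.count j).factorial : ℝ) =
      ∏ j ∈ (k ::ₘ M).toFinset, ((M.count j).factorial : ℝ) := by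
    refine Finset.prod_subset ?_ ?_
    · intro j hj
      simp only [Multiset.mem_toFinset, Multiset.mem_cons] at hj ⊢
      exact Or.inr hj
    · intro j _ hj
      rw [Multiset.mem_toFinset] at hj
      simp [Multiset.count_eq_zero_of_notMem hj]
  have hk : k ∈ (k ::ₘ M).toFinset := by simp
  rw [h, ← Finset.mul_prod_erase _ _ hk, ← Finset.mul_prod_erase _ _ hk, Multiset.count_cons_self,
    Nat.factorial_succ, ← mul_assoc]
  push_cast
  congr 1
  refine Finset.prod_congr rfl fun j hj => ?_
  rw [Multiset.count_cons_of_ne (Finset.ne_of_mem_erase hj)]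

theorem zWeight_cons (k : ℕ) (M : Multiset ℕ) :
    zWeight (k ::ₘ M) = zWeight M / (k * (M.count k + 1)) := by
  unfold zWeight
  rw [prod_factorial_count_cons, Multiset.prod_cons, div_div]
  push_cast
  congr 1
  ring

theorem zWeight_add_replicate_one {M : Multiset ℕ} (hM : 1 ∉ M) (c : ℕ) :
    zWeight (M + Multiset.replicate c 1) = zWeight M / c.factorial := by
  induction c with
  | zero => simp
  | succ c ih =>
    rw [Multiset.replicate_succ, Multiset.add_cons, zWeight_cons, ih, Nat.factorial_succ,
      Multiset.count_add, Multiset.count_eq_zero_of_notMem hM, Multiset.count_replicate_self]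
    push_cast
    rw [div_div]
    congr 1
    ring

/-- A partition is recovered from its parts of size at least two. -/
theorem parts_eq_filter_add_replicate {n : ℕ} (l : n.Partition) :
    l.parts = l.parts.filter (2 ≤ ·) +
      Multiset.replicate (n - (l.parts.filter (2 ≤ ·)).sum) 1 := by
  have h1 := Multiset.filter_add_not (2 ≤ ·) l.parts
  obtain ⟨c, hc⟩ : ∃ c, l.parts.filter (fun k => ¬ 2 ≤ k) = Multiset.replicate c 1 := by
    refine ⟨_, Multiset.eq_replicate_card.2 fun b hb => ?_⟩
    rw [Multiset.mem_filter] at hb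
    have := l.parts_pos hb.1
    omega
  have h2 := l.parts_sum
  rw [← h1, hc, Multiset.sum_add, Multiset.sum_replicate, smul_eq_mul, mul_one] at h2
  rw [hc] at h1
  rw [show n - (l.parts.filter (2 ≤ ·)).sum = c by omega]
  exact h1.symm

theorem partition_eq_iff {α : Type*} [Fintype α] [DecidableEq α] (σ : Equiv.Perm α)
    (l : (Fintype.card α).Partition) :
    σ.partition = l ↔ σ.cycleType = l.parts.filter (2 ≤ ·) := by
  constructor
  · rintro rfl
    exact Equiv.Perm.filter_parts_partition_eq_cycleType.symm
  · intro h
    rw [Nat.Partition.ext_iff, parts_eq_filter_add_replicate l, Equiv.Perm.parts_partition,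
      ← Equiv.Perm.sum_cycleType, h]

/-- Cauchy's formula for the number of permutations with given cycle lengths. Mathlib's
`Equiv.Perm.card_of_cycleType_mul_eq` treats the fixed points apart; here they are parts. -/
theorem card_partition_eq {α : Type*} [Fintype α] [DecidableEq α]
    (l : (Fintype.card α).Partition) :
    ((Finset.univ.filter fun σ : Equiv.Perm α => σ.partition = l).card : ℝ) =
      (Fintype.card α).factorial * zWeight l.parts := by
  simp_rw [partition_eq_iff]
  set m := l.parts.filter (2 ≤ ·) with hm
  have hl : l.parts = m + Multiset.replicate (Fintype.card α - m.sum) 1 :=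
    parts_eq_filter_add_replicate l
  have h1 : 1 ∉ m := by simp [hm]
  have hsum : m.sum ≤ Fintype.card α := by
    have := l.parts_sum
    rw [hl, Multiset.sum_add] at this
    omega
  have h2 : ∀ a ∈ m, 2 ≤ a := fun a ha => (Multiset.mem_filter.1 ha).2
  have hz : m.prod ≠ 0 := by
    intro h
    have := h2 0 (Multiset.prod_eq_zero_iff.1 h)
    omega
  have key := Equiv.Perm.card_of_cycleType_mul_eq α m
  rw [if_pos ⟨hsum, h2⟩] at key
  have hf : ∏ k ∈ m.toFinset, ((m.count k).factorial : ℝ) ≠ 0 :=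
    Finset.prod_ne_zero_iff.2 fun k _ => by exact_mod_cast (Nat.factorial_ne_zero _)
  have hc : ((Fintype.card α - m.sum).factorial : ℝ) ≠ 0 := by
    exact_mod_cast (Nat.factorial_ne_zero _)
  have hz' : (m.prod : ℝ) ≠ 0 := by exact_mod_cast hz
  rw [hl, zWeight_add_replicate_one h1, zWeight, ← key]
  simp only [Nat.cast_mul, Nat.cast_prod]
  rw [div_div, mul_one_div, mul_assoc, mul_comm ((Fintype.card α - m.sum).factorial : ℝ),
    mul_div_assoc, div_self (mul_ne_zero (mul_ne_zero hz' hf) hc), mul_one]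

theorem expect_comp_partition (n : ℕ) (g : (Fintype.card (Fin n)).Partition → ℝ) :
    expect n (fun σ => g σ.partition) =
      ∑ l : (Fintype.card (Fin n)).Partition, g l * zWeight l.parts := by
  have hn : ((Fintype.card (Fin n)).factorial : ℝ) ≠ 0 := by
    exact_mod_cast Nat.factorial_ne_zero _
  rw [expect, Fintype.card_perm, div_eq_iff hn, Finset.sum_mul,
    ← Finset.sum_fiberwise Finset.univ (fun σ : Equiv.Perm (Fin n) => σ.partition)]
  refine Finset.sum_congr rfl fun l _ => ?_
  rw [Finset.sum_congr rfl (g := fun _ => g l)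
    (fun σ hσ => by rw [(Finset.mem_filter.1 hσ).2]), Finset.sum_const, nsmul_eq_mul,
    card_partition_eq]
  ring

/-! ### Exact factorial moments -/

/-- The `r`-th factorial moment of the number of cycles with length satisfying `P` of a uniformly
random permutation of `n` points, as a sum over cycle types. The predicate `P` does not depend on
`n`, so that `n` can vary in recursions. -/
noncomputable def partitionMoment (P : ℕ → Prop) [DecidablePred P] (r n : ℕ) : ℝ :=
  ∑ l : n.Partition, ((l.parts.countP P).descFactorial r : ℝ) * zWeight l.parts

theorem cycleFactorialMoment_eq_partitionMoment (γ δ : ℝ) (r n : ℕ) :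
    cycleFactorialMoment γ δ r n =
      partitionMoment (fun k : ℕ => γ * (n : ℝ) ≤ (k : ℝ) ∧ (k : ℝ) ≤ δ * (n : ℝ)) r n := by
  have h := expect_comp_partition n (fun l => ((l.parts.countP
    (fun k : ℕ => γ * (n : ℝ) ≤ (k : ℝ) ∧ (k : ℝ) ≤ δ * (n : ℝ))).descFactorial r : ℝ))
  have h2 : ∀ m, m = n → partitionMoment
      (fun k : ℕ => γ * (n : ℝ) ≤ (k : ℝ) ∧ (k : ℝ) ≤ δ * (n : ℝ)) r m = partitionMoment
      (fun k : ℕ => γ * (n : ℝ) ≤ (k : ℝ) ∧ (k : ℝ) ≤ δ * (n : ℝ)) r n := by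
    rintro m rfl; rfl
  exact h.trans (h2 _ (Fintype.card_fin n))

/-- The weights of all partitions of `n` add up to `1`. -/
theorem partitionMoment_zero (P : ℕ → Prop) [DecidablePred P] (n : ℕ) :
    partitionMoment P 0 n = 1 := by
  have h := expect_comp_partition n (fun _ => 1)
  have h1 : expect n (fun _ => 1) = 1 := by
    unfold expect
    rw [Finset.sum_const, Finset.card_univ, nsmul_eq_mul, mul_one, div_self]
    exact_mod_cast Fintype.card_ne_zero
  rw [h1, Fintype.card_fin] at h
  simpa [partitionMoment] using h.symm

/-- Adjoining a part `k` to a partition of `m`. -/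
def consPart {k m n : ℕ} (hk : 0 < k) (h : k + m = n) (l : m.Partition) : n.Partition where
  parts := k ::ₘ l.parts
  parts_pos := by
    intro i hi
    rcases Multiset.mem_cons.1 hi with rfl | hi
    · exact hk
    · exact l.parts_pos hi
  parts_sum := by rw [Multiset.sum_cons, l.parts_sum, h]

/-- Removing a part `k` from a partition that has it multiplies the weight by `k` times the
multiplicity of `k`. -/
theorem sum_count_mul_zWeight {k m n : ℕ} (hk : 0 < k) (h : k + m = n) (f : Multiset ℕ → ℝ) :
    ∑ l : n.Partition, (l.parts.count k : ℝ) * zWeight l.parts * f (l.parts.erase k) =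
      1 / k * ∑ l : m.Partition, zWeight l.parts * f l.parts := by
  rw [Finset.mul_sum]
  symm
  refine Finset.sum_of_injOn (consPart hk h) ?_ (fun _ _ => by simp) ?_ ?_
  · intro a _ b _ hab
    have := congrArg Nat.Partition.parts hab
    exact Nat.Partition.ext ((Multiset.cons_inj_right k).1 this)
  · intro l _ hl
    have : k ∉ l.parts := by
      intro hmem
      refine hl ⟨⟨l.parts.erase k, fun hi => l.parts_pos (Multiset.mem_of_mem_erase hi), ?_⟩,
        by simp, Nat.Partition.ext (Multiset.cons_erase hmem)⟩
      have h1 := l.parts_sum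
      rw [← Multiset.cons_erase hmem, Multiset.sum_cons] at h1
      omega
    simp [Multiset.count_eq_zero_of_notMem this]
  · intro l _
    simp only [consPart, Multiset.count_cons_self, Multiset.erase_cons_head, zWeight_cons]
    have hk' : (k : ℝ) ≠ 0 := by exact_mod_cast hk.ne'
    have hc : (l.parts.count k : ℝ) + 1 ≠ 0 := by positivity
    push_cast
    field_simp

theorem countP_eq_sum_count (P : ℕ → Prop) [DecidablePred P] {n : ℕ} (l : n.Partition) :
    l.parts.countP P = ∑ k ∈ (Finset.Icc 1 n).filter P, l.parts.count k := by
  rw [Multiset.countP_eq_card_filter,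
    ← Multiset.sum_count_eq_card (s := (Finset.Icc 1 n).filter P)]
  · refine Finset.sum_congr rfl fun k hk => ?_
    rw [Multiset.count_filter, if_pos (Finset.mem_filter.1 hk).2]
  · intro a ha
    rw [Multiset.mem_filter] at ha
    rw [Finset.mem_filter, Finset.mem_Icc]
    exact ⟨⟨l.parts_pos ha.1, Nat.Partition.le_of_mem_parts ha.1⟩, ha.2⟩

/-- The expected number of cycles of length `k ≤ n` is `1 / k`, and deleting a chosen one leaves a
uniformly random permutation of `n - k` points, in which `r` further cycles are chosen. -/
theorem partitionMoment_succ (P : ℕ → Prop) [DecidablePred P] (r n : ℕ) :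
    partitionMoment P (r + 1) n =
      ∑ k ∈ (Finset.Icc 1 n).filter P, 1 / (k : ℝ) * partitionMoment P r (n - k) := by
  have h1 : ∀ l : n.Partition, ((l.parts.countP P).descFactorial (r + 1) : ℝ) * zWeight l.parts =
      ∑ k ∈ (Finset.Icc 1 n).filter P, (l.parts.count k : ℝ) * zWeight l.parts *
        (((l.parts.erase k).countP P).descFactorial r : ℝ) := by
    intro l
    have h2 : (l.parts.countP P).descFactorial (r + 1) =
        l.parts.countP P * (l.parts.countP P - 1).descFactorial r := by
      cases l.parts.countP P with
      | zero => simp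
      | succ c => rw [Nat.succ_descFactorial_succ, Nat.add_sub_cancel]
    rw [h2]
    nth_rw 1 [countP_eq_sum_count]
    push_cast
    rw [mul_assoc, Finset.sum_mul]
    refine Finset.sum_congr rfl fun k hk => ?_
    by_cases hmem : k ∈ l.parts
    · rw [← Multiset.cons_erase hmem, Multiset.countP_cons_of_pos _ (Finset.mem_filter.1 hk).2,
        Multiset.cons_erase hmem, Nat.add_sub_cancel]
      ring
    · simp [Multiset.count_eq_zero_of_notMem hmem]
  unfold partitionMoment
  simp_rw [h1]
  rw [Finset.sum_comm]
  refine Finset.sum_congr rfl fun k hk => ?_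
  rw [Finset.mem_filter, Finset.mem_Icc] at hk
  rw [sum_count_mul_zWeight hk.1.1 (Nat.add_sub_cancel' hk.1.2)
    (fun M => ((M.countP P).descFactorial r : ℝ))]
  simp_rw [mul_comm (zWeight _)]

/-- The factorial moment is the sum of `1 / (k₁ ⋯ k_r)` over the admissible tuples with
`k₁ + ⋯ + k_r ≤ n`. The entries range over `Fin (N + 1)` with `N` any bound on `n`, so that the
index type stays fixed when `n` decreases along the recursion. -/
theorem partitionMoment_eq_sum_tuples (P : ℕ → Prop) [DecidablePred P] (hP : ¬ P 0) (N r n : ℕ)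
    (hn : n ≤ N) :
    partitionMoment P r n = ∑ f : Fin r → Fin (N + 1),
      if (∀ j, P (f j)) ∧ ∑ j, (f j : ℕ) ≤ n then ∏ j, 1 / ((f j : ℕ) : ℝ) else 0 := by
  induction r generalizing n with
  | zero => simp [partitionMoment_zero]
  | succ r ih =>
    rw [partitionMoment_succ, ← (Fin.consEquiv fun _ : Fin (r + 1) => Fin (N + 1)).sum_comp,
      Fintype.sum_prod_type]
    have hIcc : (Finset.Icc 1 n).filter P = (Finset.range (N + 1)).filter
        fun k => P k ∧ k ≤ n := by
      ext k
      simp only [Finset.mem_filter, Finset.mem_Icc, Finset.mem_range]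
      constructor
      · rintro ⟨⟨h1, h2⟩, h3⟩
        exact ⟨by omega, h3, h2⟩
      · rintro ⟨h1, h2, h3⟩
        refine ⟨⟨Nat.pos_of_ne_zero ?_, h3⟩, h2⟩
        rintro rfl
        exact hP h2
    rw [hIcc, Finset.sum_filter, Finset.sum_range]
    refine Finset.sum_congr rfl fun k _ => ?_
    simp only [Fin.consEquiv_apply, Fin.forall_fin_succ, Fin.cons_zero, Fin.cons_succ,
      Fin.sum_univ_succ, Fin.prod_univ_succ]
    split_ifs with hk
    · rw [ih (n - k) (by omega), Finset.mul_sum]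
      refine Finset.sum_congr rfl fun f _ => ?_
      have : (k : ℕ) + ∑ j, (f j : ℕ) ≤ n ↔ ∑ j, (f j : ℕ) ≤ n - k := by omega
      rw [mul_ite, mul_zero]
      simp only [this, hk.1, true_and]
    · symm
      refine Finset.sum_eq_zero fun f _ => if_neg ?_
      rintro ⟨⟨h1, _⟩, h3⟩
      exact hk ⟨h1, by omega⟩


/-! ### Factorial moments as Riemann sums -/

theorem convex_slicedCube (γ δ : ℝ) (r : ℕ) : Convex ℝ (slicedCube γ δ r) := by
  have h : slicedCube γ δ r = Set.Icc (fun _ => γ) (fun _ => δ) ∩ {z | ∑ j, z j ≤ 1} := by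
    ext z
    simp [slicedCube, Pi.le_def, forall_and]
  rw [h]
  refine (convex_Icc _ _).inter (convex_halfSpace_le ⟨fun x y => ?_, fun c x => ?_⟩ 1)
  · simp [Finset.sum_add_distrib]
  · simp [Finset.mul_sum]

theorem isCompact_slicedCube (γ δ : ℝ) (r : ℕ) : IsCompact (slicedCube γ δ r) := by
  have h : slicedCube γ δ r = Set.Icc (fun _ => γ) (fun _ => δ) ∩ {z | ∑ j, z j ≤ 1} := by
    ext z
    simp [slicedCube, Pi.le_def, forall_and]
  rw [h]
  exact isCompact_Icc.inter_right (isClosed_le (by fun_prop) continuous_const)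

open scoped Pointwise in
/-- The points of the lattice `n⁻¹ ℤ^r` in the sliced cube are the tuples of admissible cycle
lengths divided by `n`. -/
theorem slicedCube_inter_lattice_eq_image (γ δ : ℝ) (hγ : 0 < γ) (r n : ℕ) (hn : 0 < n) :
    slicedCube γ δ r ∩
        ((n : ℝ)⁻¹ • (Submodule.span ℤ (Set.range (Pi.basisFun ℝ (Fin r))) : Set (Fin r → ℝ))) =
      ((Finset.univ.filter fun f : Fin r → Fin (n + 1) =>
        (∀ j, γ * (n : ℝ) ≤ ((f j : ℕ) : ℝ) ∧ ((f j : ℕ) : ℝ) ≤ δ * (n : ℝ)) ∧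
          ∑ j, (f j : ℕ) ≤ n).image fun f j => ((f j : ℕ) : ℝ) / n :
        Finset (Fin r → ℝ)) := by
  have hn' : (0 : ℝ) < n := by exact_mod_cast hn
  have : NeZero n := ⟨hn.ne'⟩
  have hsum : ∀ f : Fin r → ℕ, ∑ j, (f j : ℝ) / n ≤ 1 ↔ ∑ j, f j ≤ n := by
    intro f
    rw [← Finset.sum_div, div_le_one hn']
    exact_mod_cast Iff.rfl
  ext z
  have hlattice : ∀ y : Fin r → ℝ,
      y ∈ (n : ℝ)⁻¹ • (Submodule.span ℤ (Set.range (Pi.basisFun ℝ (Fin r))) : Set (Fin r → ℝ)) ↔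
        ∀ j, n * y j ∈ Set.range (algebraMap ℤ ℝ) :=
    fun _ => BoxIntegral.unitPartition.mem_smul_span_iff
  simp only [Set.mem_inter_iff, hlattice, Finset.coe_image,
    Set.mem_image, Finset.coe_filter, Finset.mem_univ, true_and]
  constructor
  · rintro ⟨⟨hz1, hz2⟩, hz3⟩
    have hex : ∀ j, ∃ k : ℕ, z j = (k : ℝ) / n := by
      intro j
      obtain ⟨i, hi⟩ := hz3 j
      have hpos : (0 : ℝ) < n * z j := mul_pos hn' (hγ.trans_le (hz1 j).1)
      have hi' : (i : ℝ) = n * z j := by simpa using hi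
      rw [← hi'] at hpos
      have hi0 : 0 ≤ i := by exact_mod_cast hpos.le
      lift i to ℕ using hi0
      refine ⟨i, ?_⟩
      rw [eq_div_iff hn'.ne', mul_comm, ← hi']
      simp
    choose f hf using hex
    have hle : ∑ j, f j ≤ n := by
      rw [← hsum]
      simpa only [hf] using hz2
    have hlt : ∀ j, f j < n + 1 := fun j =>
      Nat.lt_succ_of_le ((Finset.single_le_sum (fun _ _ => Nat.zero_le _)
        (Finset.mem_univ j)).trans hle)
    refine ⟨fun j => ⟨f j, hlt j⟩, ⟨fun j => ?_, hle⟩, funext fun j => (hf j).symm⟩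
    have := hz1 j
    rw [hf j, le_div_iff₀ hn', div_le_iff₀ hn'] at this
    exact this
  · rintro ⟨f, ⟨hf1, hf2⟩, rfl⟩
    refine ⟨⟨fun j => ?_, (hsum fun j => (f j : ℕ)).2 hf2⟩, fun j => ⟨(f j : ℕ), ?_⟩⟩
    · rw [le_div_iff₀ hn', div_le_iff₀ hn']
      exact hf1 j
    · have := hn'.ne'
      simp
      field_simp

/-- The factorial moments are Riemann sums, of mesh `1 / n`, of the integral defining
`limitMoment`. The sliced cube is compact and convex, so its frontier is a null set and the
Riemann sums converge. -/
theorem tendsto_cycleFactorialMoment (γ δ : ℝ) (hγ : 0 < γ) (r : ℕ) :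
    Tendsto (fun n : ℕ => cycleFactorialMoment γ δ r n) atTop (𝓝 (limitMoment γ δ r)) := by
  -- `max` extends the integrand from the sliced cube to a continuous function on `ℝ^r`.
  have hF : Continuous fun z : Fin r → ℝ => ∏ j, 1 / max (z j) γ := by
    refine continuous_finsetProd _ fun j _ => continuous_const.div (by fun_prop) fun z => ?_
    exact (hγ.trans_le (le_max_right _ _)).ne'
  have h := tendsto_tsum_div_pow_atTop_integral (slicedCube γ δ r) _ hF
    (isCompact_slicedCube γ δ r).isBounded (isCompact_slicedCube γ δ r).measurableSet
    ((convex_slicedCube γ δ r).addHaar_frontier volume)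
  have hint : ∫ z in slicedCube γ δ r, ∏ j, 1 / max (z j) γ = limitMoment γ δ r := by
    refine setIntegral_congr_fun (isCompact_slicedCube γ δ r).measurableSet fun z hz => ?_
    simp only [max_eq_left (hz.1 _).1, one_div, Finset.prod_inv_distrib]
  rw [hint] at h
  refine h.congr' ?_
  filter_upwards [eventually_gt_atTop 0] with n hn
  have hn' : (0 : ℝ) < n := by exact_mod_cast hn
  rw [cycleFactorialMoment_eq_partitionMoment, partitionMoment_eq_sum_tuples _ ?_ n r n le_rfl,
    slicedCube_inter_lattice_eq_image γ δ hγ r n hn,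
    Finset.tsum_subtype' _ (fun z : Fin r → ℝ => ∏ j, 1 / max (z j) γ),
    Finset.sum_image, ← Finset.sum_filter, Finset.sum_div]
  · refine Finset.sum_congr rfl fun f hf => ?_
    have hf1 := (Finset.mem_filter.1 hf).2.1
    have hmax : ∀ j, max (((f j : ℕ) : ℝ) / n) γ = ((f j : ℕ) : ℝ) / n := fun j =>
      max_eq_left (by rw [le_div_iff₀ hn']; exact (hf1 j).1)
    simp only [hmax, one_div_div, Finset.prod_div_distrib, Finset.prod_const, Finset.card_univ,
      Fintype.card_fin]
    rw [div_right_comm, div_self (pow_ne_zero _ hn'.ne'), one_pow]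
  · intro f _ g _ hfg
    funext j
    have := congrFun hfg j
    simp only [div_left_inj' hn'.ne', Nat.cast_inj] at this
    exact Fin.ext this
  · -- Length zero is not admissible, as `γ n > 0`.
    rintro ⟨h0, -⟩
    rw [Nat.cast_zero] at h0
    exact absurd h0 (not_le.2 (mul_pos hγ hn'))

/-! ### Recovering the distribution from its factorial moments -/

theorem cycleCount_le_floor (γ δ : ℝ) (hγ : 0 < γ) {n : ℕ} (hn : 0 < n)
    (σ : Equiv.Perm (Fin n)) : cycleCount γ δ σ ≤ ⌊γ⁻¹⌋₊ := by
  have hn' : (0 : ℝ) < n := by exact_mod_cast hn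
  rw [Nat.le_floor_iff (inv_nonneg.2 hγ.le), ← one_div, le_div_iff₀ hγ]
  set s := σ.partition.parts.filter
    (fun k : ℕ => γ * (n : ℝ) ≤ (k : ℝ) ∧ (k : ℝ) ≤ δ * (n : ℝ)) with hs
  have hcard : cycleCount γ δ σ = s.card := Multiset.countP_eq_card_filter ..
  have h1 : (s.card : ℝ) * (γ * n) ≤ (s.map (fun k : ℕ => (k : ℝ))).sum := by
    have := Multiset.card_nsmul_le_sum (s := s.map (fun k : ℕ => (k : ℝ))) (a := γ * n) (by
      intro x hx
      obtain ⟨k, hk, rfl⟩ := Multiset.mem_map.1 hx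
      exact (Multiset.mem_filter.1 hk).2.1)
    simpa using this
  have h2 : s.sum ≤ n := by
    have h4 := σ.partition.parts_sum
    rw [← Multiset.filter_add_not (fun k : ℕ => γ * (n : ℝ) ≤ (k : ℝ) ∧ (k : ℝ) ≤ δ * (n : ℝ))
      σ.partition.parts, ← hs, Multiset.sum_add] at h4
    have h5 := Fintype.card_fin n
    omega
  have h3 : (s.map (fun k : ℕ => (k : ℝ))).sum ≤ n := by
    rw [← Nat.cast_multiset_sum]
    exact_mod_cast h2
  rw [hcard]
  have : (s.card : ℝ) * γ * n ≤ 1 * n := by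
    rw [one_mul, mul_assoc]
    exact h1.trans h3
  exact le_of_mul_le_mul_right this hn'

theorem cycleProb_eq_zero (γ δ : ℝ) (hγ : 0 < γ) {i n : ℕ} (hn : 0 < n) (hi : ⌊γ⁻¹⌋₊ < i) :
    cycleProb γ δ i n = 0 := by
  rw [cycleProb, Finset.filter_false_of_mem, Finset.card_empty, Nat.cast_zero, zero_div]
  intro σ _ h
  have := cycleCount_le_floor γ δ hγ hn σ
  omega

/-- The expectation defining the factorial moment, grouped by the value of the cycle count. The
count never exceeds `⌊γ⁻¹⌋₊`, so no value is missed. -/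
theorem sum_descFactorial_mul_cycleProb (γ δ : ℝ) (hγ : 0 < γ) (r : ℕ) {n : ℕ} (hn : 0 < n) :
    ∑ j : Fin (⌊γ⁻¹⌋₊ + 1), ((j : ℕ).descFactorial r : ℝ) * cycleProb γ δ j n =
      cycleFactorialMoment γ δ r n := by
  unfold cycleProb cycleFactorialMoment expect
  simp_rw [← mul_div_assoc]
  rw [← Finset.sum_div]
  congr 1
  rw [← Finset.sum_fiberwise_of_maps_to (t := (Finset.univ : Finset (Fin (⌊γ⁻¹⌋₊ + 1))))
    (g := fun σ : Equiv.Perm (Fin n) =>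
      ⟨cycleCount γ δ σ, Nat.lt_succ_of_le (cycleCount_le_floor γ δ hγ hn σ)⟩)
    (fun _ _ => Finset.mem_univ _)]
  refine Finset.sum_congr rfl fun j _ => ?_
  have hfilter : ∀ σ : Equiv.Perm (Fin n),
      (⟨cycleCount γ δ σ, Nat.lt_succ_of_le (cycleCount_le_floor γ δ hγ hn σ)⟩ :
        Fin (⌊γ⁻¹⌋₊ + 1)) = j ↔ cycleCount γ δ σ = j := fun σ => Fin.ext_iff
  simp only [hfilter]
  rw [Finset.sum_congr rfl (g := fun _ => ((j : ℕ).descFactorial r : ℝ))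
    (fun σ hσ => by rw [(Finset.mem_filter.1 hσ).2]), Finset.sum_const, nsmul_eq_mul, mul_comm]

/-- The matrix `(j)_r`, with row index `r` and column index `j`, sending a distribution on
`{0, …, m - 1}` to its first `m` factorial moments. -/
def descFactorialMatrix (m : ℕ) : Matrix (Fin m) (Fin m) ℝ :=
  Matrix.of fun r j => ((j : ℕ).descFactorial (r : ℕ) : ℝ)

theorem isUnit_det_descFactorialMatrix (m : ℕ) : IsUnit (descFactorialMatrix m).det := by
  rw [Matrix.det_of_isUpperTriangular, isUnit_iff_ne_zero, Finset.prod_ne_zero_iff]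
  · intro i _
    simp [descFactorialMatrix, Nat.descFactorial_self, Nat.factorial_ne_zero]
  · intro r j hjr
    have : (j : ℕ) < r := hjr
    simp [descFactorialMatrix, Nat.descFactorial_eq_zero_iff_lt.2 this]

end LongCycles

theorem mainTheorem7 (γ δ : ℝ) (hγ : 0 < γ) (hγδ : γ < δ) (hδ : δ ≤ 1) :
    (∀ r : ℕ, Tendsto (fun n : ℕ => LongCycles.cycleFactorialMoment γ δ r n) atTop
        (𝓝 (LongCycles.limitMoment γ δ r))) ∧
    ∃ p : ℕ → ℝ,
      (∀ i : ℕ, Tendsto (fun n : ℕ => LongCycles.cycleProb γ δ i n) atTop (𝓝 (p i))) ∧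
      (∀ i : ℕ, ⌊γ⁻¹⌋₊ < i → p i = 0) ∧
      (∀ x : Fin (⌊γ⁻¹⌋₊ + 1) → ℝ,
        (∀ r : Fin (⌊γ⁻¹⌋₊ + 1),
          ∑ j : Fin (⌊γ⁻¹⌋₊ + 1), ((j : ℕ).descFactorial (r : ℕ) : ℝ) * x j =
            LongCycles.limitMoment γ δ (r : ℕ)) ↔
        ∀ j : Fin (⌊γ⁻¹⌋₊ + 1), x j = p (j : ℕ)) := by
  have hmoment := LongCycles.tendsto_cycleFactorialMoment γ δ hγ
  set K := ⌊γ⁻¹⌋₊ with hK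
  set A := LongCycles.descFactorialMatrix (K + 1) with hA
  have hdet : IsUnit A.det := LongCycles.isUnit_det_descFactorialMatrix (K + 1)
  set q : Fin (K + 1) → ℝ := fun r => LongCycles.limitMoment γ δ r with hq
  -- The moments of order `0, …, K` determine the probabilities through the inverse of `A`.
  have hprob : Tendsto (fun (n : ℕ) (j : Fin (K + 1)) => LongCycles.cycleProb γ δ j n) atTop
      (𝓝 (A⁻¹.mulVec q)) := by
    have hm : Tendsto (fun (n : ℕ) (r : Fin (K + 1)) => LongCycles.cycleFactorialMoment γ δ r n)
        atTop (𝓝 q) := tendsto_pi_nhds.2 fun r => hmoment r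
    have hcont : Continuous fun v : Fin (K + 1) → ℝ => A⁻¹.mulVec v :=
      continuous_const.matrix_mulVec continuous_id
    refine ((hcont.tendsto q).comp hm).congr' ?_
    filter_upwards [eventually_gt_atTop 0] with n hn
    have h : (fun r : Fin (K + 1) => LongCycles.cycleFactorialMoment γ δ r n) =
        A.mulVec fun j : Fin (K + 1) => LongCycles.cycleProb γ δ j n :=
      funext fun r => (LongCycles.sum_descFactorial_mul_cycleProb γ δ hγ r hn).symm
    rw [Function.comp_apply, h, Matrix.mulVec_mulVec, Matrix.nonsing_inv_mul A hdet,
      Matrix.one_mulVec]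
  refine ⟨hmoment, fun i => if h : i < K + 1 then A⁻¹.mulVec q ⟨i, h⟩ else 0, fun i => ?_,
    fun i hi => dif_neg (by omega), fun x => ?_⟩
  · by_cases hi : i < K + 1
    · simpa only [dif_pos hi] using tendsto_pi_nhds.1 hprob ⟨i, hi⟩
    · simp only [dif_neg hi]
      refine tendsto_const_nhds.congr' ?_
      filter_upwards [eventually_gt_atTop 0] with n hn
      exact (LongCycles.cycleProb_eq_zero γ δ hγ hn (by omega)).symm
  · have hsys : (∀ r : Fin (K + 1),
        ∑ j : Fin (K + 1), ((j : ℕ).descFactorial (r : ℕ) : ℝ) * x j =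
          LongCycles.limitMoment γ δ (r : ℕ)) ↔ A.mulVec x = q := funext_iff.symm
    have hsol : (∀ j : Fin (K + 1), x j =
        if h : (j : ℕ) < K + 1 then A⁻¹.mulVec q ⟨j, h⟩ else 0) ↔ x = A⁻¹.mulVec q := by
      rw [funext_iff]
      exact forall_congr' fun j => by rw [dif_pos j.isLt]
    rw [hsys, hsol]
    constructor
    · rintro h
      rw [← h, Matrix.mulVec_mulVec, Matrix.nonsing_inv_mul A hdet, Matrix.one_mulVec]
    · rintro rfl
      rw [Matrix.mulVec_mulVec, Matrix.mul_nonsing_inv A hdet, Matrix.one_mulVec]
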